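/- Let $N\ge 1$, let $\Omega\subset\mathbb R^N$ be a bounded open set, and let $p>1$, $c_1,c_2>0$, $\alpha>0$, $c_0>0$ and $m\in(N/\alpha,\infty]$ be given. Then there is a constant $c>0$, depending only on $N,\Omega,p,c_1,c_2,\alpha,c_0$ and $m$, such that the following holds. Let $\psi:\mathbb R\to\mathbb R$ be nondecreasing, continuous, unbounded and odd, with $$c_1s^{p-1}\le\psi(s)\le c_2s^{p-1}\qquad\text{for all } s>0,$$ and put $\Psi(s)=\int_0^s\psi(t)\,dt$. Let $J:\mathbb R^N\to\mathbb R$ be measurable with $J(z)>0$ for $z\ne0$, $J(-z)=J(z)$, $J\notin L^1(\{|z|<1\})$, $\int_{\mathbb R^N}\min(1,|z|^{q_0})J(z)\,dz<\infty$ for some $q_0>0$, and $$J(z)\ge c_0|z|^{-N-\alpha}\qquad\text{for } 0<|z|<1.$$ For measurable $u,\varphi:\mathbb R^N\to\mathbb R$ write $$E(u)=\frac12\iint_{\mathbb R^{2N}}\Psi(u(x)-u(y))J(x-y)\,dx\,dy,$$ $$\mathcal E(u;\varphi)=\frac12\iint_{\mathbb R^{2N}}\psi(u(x)-u(y))(\varphi(x)-\varphi(y))J(x-y)\,dx\,dy,$$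 and let $W_0^{J,\Psi}(\Omega)$ be the set of measurable $u:\mathbb R^N\to\mathbb R$ with $\int_{\mathbb R^N}\Psi(u)\,dx<\infty$, $E(u)<\infty$ and $u=0$ a.e. in $\mathbb R^N\setminus\Omega$. Let $f\in L^m(\Omega)$, and let $u$ be a weak solution of $\mathcal Lu=f$ in $\Omega$, $u=0$ in $\mathbb R^N\setminus\Omega$; that is, $u\in W_0^{J,\Psi}(\Omega)$ and $$\mathcal E(u;\varphi)=\int_\Omega f\varphi\,dx\qquad\text{for every }\varphi\in W_0^{J,\Psi}(\Omega),$$ both integrals being absolutely convergent. Then $u\in L^\infty(\Omega)$ and $$\|u\|_{L^\infty(\Omega)}\le c\left(E(u)^{1/p}+\|f\|_{L^m(\Omega)}^{1/(p-1)}\right).$$ (If $m<1$, $\|f\|_{L^m(\Omega)}$ stands for $\left(\int_\Omega|f|^m\,dx\right)^{1/m}$.) -/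

import Mathlib

noncomputable section

namespace NonlocalOrlicz

open MeasureTheory

/-- Standing assumptions on the nonlinearity `ψ : ℝ → ℝ`: nondecreasing, continuous, unbounded
and odd. -/
structure IsNonlinearity (ψ : ℝ → ℝ) : Prop where
  monotone : Monotone ψ
  continuous : Continuous ψ
  unbounded : ¬ Bornology.IsBounded (Set.range ψ)
  odd : ∀ s, ψ (-s) = -ψ s

/-- Two-sided power bound `c₁ s ^ (p - 1) ≤ ψ s ≤ c₂ s ^ (p - 1)` for `s > 0`. -/
def IsPowerLike (p c₁ c₂ : ℝ) (ψ : ℝ → ℝ) : Prop :=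
  ∀ s : ℝ, 0 < s → c₁ * s ^ (p - 1) ≤ ψ s ∧ ψ s ≤ c₂ * s ^ (p - 1)

/-- Standing assumptions on the kernel `J`: measurable, positive, even, not integrable on the unit
ball, and `∫ min(1, |z| ^ q₀) J(z) dz < ∞` for some `q₀ > 0`. The value at the singular point
`z = 0` is immaterial (a null set), so positivity is only asked away from it. -/
structure IsKernel {N : ℕ} (J : EuclideanSpace ℝ (Fin N) → ℝ) : Prop where
  measurable : Measurable J
  pos : ∀ z, z ≠ 0 → 0 < J z
  even : ∀ z, J (-z) = J z
  not_integrable : ¬ IntegrableOn J (Metric.ball 0 1)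
  levy : ∃ q₀ : ℝ, 0 < q₀ ∧ Integrable (fun z => min 1 (‖z‖ ^ q₀) * J z)

/-- Singularity of the kernel at the origin: `J(z) ≥ c |z| ^ (-N - α)` for `0 < |z| < 1`. -/
def HasSingularity {N : ℕ} (α c : ℝ) (J : EuclideanSpace ℝ (Fin N) → ℝ) : Prop :=
  ∀ z, 0 < ‖z‖ → ‖z‖ < 1 → c * ‖z‖ ^ (-(N : ℝ) - α) ≤ J z

/-- The primitive `Ψ` of `ψ` with `Ψ 0 = 0`. It is even and nonnegative when `ψ` is odd and
nondecreasing. -/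
def primitive (ψ : ℝ → ℝ) (s : ℝ) : ℝ := ∫ t in (0 : ℝ)..s, ψ t

/-- `F(u) = ∫ Ψ(u(x)) dx`, with values in `[0, ∞]`. -/
def modular {N : ℕ} (ψ : ℝ → ℝ) (u : EuclideanSpace ℝ (Fin N) → ℝ) : ENNReal :=
  ∫⁻ x, ENNReal.ofReal (primitive ψ (u x))

/-- `E(u) = (1/2) ∬ Ψ(u(x) - u(y)) J(x - y) dx dy`, with values in `[0, ∞]`. -/
def energy {N : ℕ} (ψ : ℝ → ℝ) (J u : EuclideanSpace ℝ (Fin N) → ℝ) : ENNReal :=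
  2⁻¹ * ∫⁻ z : EuclideanSpace ℝ (Fin N) × EuclideanSpace ℝ (Fin N),
    ENNReal.ofReal (primitive ψ (u z.1 - u z.2) * J (z.1 - z.2))

/-- The integrand `ψ(u(x) - u(y)) (φ(x) - φ(y)) J(x - y)` of the interaction energy. -/
def interactionDensity {N : ℕ} (ψ : ℝ → ℝ) (J u φ : EuclideanSpace ℝ (Fin N) → ℝ)
    (z : EuclideanSpace ℝ (Fin N) × EuclideanSpace ℝ (Fin N)) : ℝ :=
  ψ (u z.1 - u z.2) * (φ z.1 - φ z.2) * J (z.1 - z.2)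

/-- The interaction energy
`𝓔(u; φ) = (1/2) ∬ ψ(u(x) - u(y)) (φ(x) - φ(y)) J(x - y) dx dy`. -/
def interaction {N : ℕ} (ψ : ℝ → ℝ) (J u φ : EuclideanSpace ℝ (Fin N) → ℝ) : ℝ :=
  2⁻¹ * ∫ z, interactionDensity ψ J u φ z

/-- Membership in the space `W₀^{J,Ψ}(Ω)`: measurable functions on the whole space with
`F(u) < ∞` and `E(u) < ∞` that vanish (almost everywhere) outside `Ω`. -/
structure MemW₀ {N : ℕ} (ψ : ℝ → ℝ) (J : EuclideanSpace ℝ (Fin N) → ℝ)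
    (Ω : Set (EuclideanSpace ℝ (Fin N))) (u : EuclideanSpace ℝ (Fin N) → ℝ) : Prop where
  aemeasurable : AEMeasurable u
  modular_lt_top : modular ψ u < ⊤
  energy_lt_top : energy ψ J u < ⊤
  eq_zero : ∀ᵐ x, x ∉ Ω → u x = 0

/-- `u` is a weak solution of `𝓛 u = f` in `Ω`, `u = 0` in the complement of `Ω`: it belongs to
`W₀^{J,Ψ}(Ω)` and `𝓔(u; φ) = ∫_Ω f φ` for all `φ` in `W₀^{J,Ψ}(Ω)`, where both integrals converge
absolutely. -/
structure IsWeakSolution {N : ℕ} (ψ : ℝ → ℝ) (J : EuclideanSpace ℝ (Fin N) → ℝ)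
    (Ω : Set (EuclideanSpace ℝ (Fin N))) (f u : EuclideanSpace ℝ (Fin N) → ℝ) : Prop where
  mem : MemW₀ ψ J Ω u
  integrable_density : ∀ φ, MemW₀ ψ J Ω φ → Integrable (interactionDensity ψ J u φ)
  integrable_pairing : ∀ φ, MemW₀ ψ J Ω φ → IntegrableOn (fun x => f x * φ x) Ω
  eq : ∀ φ, MemW₀ ψ J Ω φ → interaction ψ J u φ = ∫ x in Ω, f x * φ x

end NonlocalOrlicz

end

/-!
The boundedness of weak solutions is proved by an iteration over the superlevel sets
`A k = {x | k < |u x|}`, without any Sobolev inequality.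

* Geometry of the kernel (`le_lintegral_kernel`): if `|A| ≤ |B₁| / 2`, every point sees a fixed
  fraction of a ball of measure `2 |A|` outside `A`, so the singularity of `J` gives
  `∬_{B × Aᶜ} J(x - y) ≥ κ |A| ^ (-α / N) |B|`.
* Starting level (`exists_volume_superlevel_le`): moving by steps `e` with `1 / 2 < |e| < 1`, one
  leaves the bounded set `Ω` after a fixed number of steps, so a large value of `u` forces a large
  jump of `u` along some step. Averaging over `e` gives `k ^ p |A k| ≤ C E(u)`, hence
  `|A k₀| ≤ |B₁| / 2` for some `k₀` comparable to `E(u) ^ (1 / p)`.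
* Decay (`exists_ae_abs_le`): for `k₀ ≤ k < h`, test the equation with the part `slab k h u` of `u`
  between the heights `k` and `h`. The interaction density is nonnegative, and at least
  `c₁ (h - k) ^ p J(x - y)` on `A h × (A k)ᶜ`; the right-hand side is at most
  `(h - k) ‖f‖_m |A k| ^ (1 - 1 / m)` by Hölder. Together with the geometric estimate,
  `(h - k) ^ (p - 1) |A h| ≤ C ‖f‖_m |A k| ^ (1 - 1 / m + α / N)`, and the last exponent exceeds one
  exactly because `m > N / α`. Hölder needs `m ≥ 1`; if `m < 1` then `α > N`, and bounding the
  energy from below on `A h × (A k)ᶜ` gives `(h - k) ^ p |A h| ≤ C E(u) |A k| ^ (α / N)`, again with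
  an exponent larger than one.
* Stampacchia's lemma (`eq_zero_of_stampacchia`) turns either decay into `|A (k₀ + d)| = 0`, where
  `d` is comparable to `‖f‖_m ^ (1 / (p - 1))`, respectively to `E(u) ^ (1 / p)`.

When the energy or `f` vanishes, the natural choice of `k₀` or `d` is zero, which the estimates do
not allow; therefore all levels are enlarged by an arbitrary `ε > 0`.
-/

open MeasureTheory Set
open scoped ENNReal

namespace NonlocalOrlicz

/-! ### The nonlinearity and its primitive -/

theorem IsNonlinearity.map_zero {ψ : ℝ → ℝ} (hψ : IsNonlinearity ψ) : ψ 0 = 0 := by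
  have := hψ.odd 0
  rw [neg_zero] at this
  linarith

theorem IsNonlinearity.nonneg {ψ : ℝ → ℝ} (hψ : IsNonlinearity ψ) {s : ℝ} (hs : 0 ≤ s) :
    0 ≤ ψ s := hψ.map_zero ▸ hψ.monotone hs

theorem IsNonlinearity.primitive_abs {ψ : ℝ → ℝ} (hψ : IsNonlinearity ψ) (s : ℝ) :
    primitive ψ |s| = primitive ψ s := by
  rcases abs_choice s with h | h
  · rw [h]
  · rw [h, primitive, primitive]
    have := intervalIntegral.integral_comp_neg (f := ψ) (a := 0) (b := s)
    simp only [hψ.odd, neg_zero, intervalIntegral.integral_neg] at this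
    rw [intervalIntegral.integral_symm, ← this, neg_neg]

theorem IsNonlinearity.primitive_mono {ψ : ℝ → ℝ} (hψ : IsNonlinearity ψ) {s t : ℝ}
    (hst : |s| ≤ |t|) : primitive ψ s ≤ primitive ψ t := by
  rw [← hψ.primitive_abs s, ← hψ.primitive_abs t, primitive, primitive]
  refine intervalIntegral.integral_mono_interval le_rfl (abs_nonneg s) hst ?_
    (hψ.continuous.intervalIntegrable _ _)
  filter_upwards [ae_restrict_mem measurableSet_Ioc] with x hx using hψ.nonneg hx.1.le

theorem primitive_zero (ψ : ℝ → ℝ) : primitive ψ 0 = 0 := by simp [primitive]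

theorem IsNonlinearity.primitive_nonneg {ψ : ℝ → ℝ} (hψ : IsNonlinearity ψ) (s : ℝ) :
    0 ≤ primitive ψ s := by
  rw [← primitive_zero ψ]
  exact hψ.primitive_mono (by simp)

theorem IsNonlinearity.continuous_primitive {ψ : ℝ → ℝ} (hψ : IsNonlinearity ψ) :
    Continuous (primitive ψ) :=
  intervalIntegral.continuous_primitive (fun _ _ => hψ.continuous.intervalIntegrable _ _) 0

theorem IsNonlinearity.le_primitive {ψ : ℝ → ℝ} (hψ : IsNonlinearity ψ) {p c₁ c₂ : ℝ}
    (hp : 1 < p) (hpow : IsPowerLike p c₁ c₂ ψ) {s : ℝ} (hs : 0 ≤ s) :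
    c₁ / p * s ^ p ≤ primitive ψ s := by
  have h : ∫ t in (0 : ℝ)..s, c₁ * t ^ (p - 1) = c₁ / p * s ^ p := by
    rw [intervalIntegral.integral_const_mul, integral_rpow (Or.inl (by linarith)),
      sub_add_cancel, Real.zero_rpow (by linarith)]
    ring
  rw [← h]
  refine intervalIntegral.integral_mono_on_of_le_Ioo hs
    ((intervalIntegral.intervalIntegrable_rpow' (by linarith)).const_mul _)
    (hψ.continuous.intervalIntegrable _ _) fun t ht => (hpow t ht.1).1

/-! ### Slab truncations -/

/-- Projection of the real line onto the interval `[-k, k]`. -/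
def clip (k s : ℝ) : ℝ := max (-k) (min k s)

/-- The part of `s` between the heights `k` and `h`, with sign: for `0 ≤ k ≤ h` this odd function
vanishes on `[-k, k]`, has slope one on `k < |s| < h` and is constant on either side of
`[-h, h]`. -/
def slab (k h s : ℝ) : ℝ := clip h s - clip k s

theorem continuous_slab (k h : ℝ) : Continuous (slab k h) := by
  unfold slab clip
  fun_prop

section slab

variable {k h : ℝ}

theorem slab_sub_nonneg (hk : 0 ≤ k) (hkh : k ≤ h) {s t : ℝ} (hst : s ≤ t) :
    0 ≤ slab k h t - slab k h s := by
  simp only [slab, clip, max_def, min_def]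
  split_ifs <;> linarith

theorem slab_sub_le (hk : 0 ≤ k) (hkh : k ≤ h) {s t : ℝ} (hst : s ≤ t) :
    slab k h t - slab k h s ≤ t - s := by
  simp only [slab, clip, max_def, min_def]
  split_ifs <;> linarith

theorem slab_of_abs_le (hk : 0 ≤ k) (hkh : k ≤ h) {s : ℝ} (hs : |s| ≤ k) : slab k h s = 0 := by
  rw [abs_le] at hs
  simp only [slab, clip, max_def, min_def]
  split_ifs <;> linarith

theorem slab_of_le (hk : 0 ≤ k) (hkh : k ≤ h) {s : ℝ} (hs : h ≤ s) : slab k h s = h - k := by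
  simp only [slab, clip, max_def, min_def]
  split_ifs <;> linarith

theorem slab_of_le_neg (hk : 0 ≤ k) (hkh : k ≤ h) {s : ℝ} (hs : s ≤ -h) :
    slab k h s = -(h - k) := by
  simp only [slab, clip, max_def, min_def]
  split_ifs <;> linarith

theorem abs_slab_le (hk : 0 ≤ k) (hkh : k ≤ h) (s : ℝ) : |slab k h s| ≤ h - k := by
  rw [abs_le]
  simp only [slab, clip, max_def, min_def]
  constructor <;> split_ifs <;> linarith

theorem abs_slab_sub_le (hk : 0 ≤ k) (hkh : k ≤ h) (s t : ℝ) :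
    |slab k h s - slab k h t| ≤ |s - t| := by
  rcases le_total t s with hst | hst
  · rw [abs_of_nonneg (slab_sub_nonneg hk hkh hst), abs_of_nonneg (sub_nonneg.2 hst)]
    exact slab_sub_le hk hkh hst
  · rw [abs_sub_comm, abs_sub_comm s, abs_of_nonneg (slab_sub_nonneg hk hkh hst),
      abs_of_nonneg (sub_nonneg.2 hst)]
    exact slab_sub_le hk hkh hst

theorem slab_zero (hk : 0 ≤ k) (hkh : k ≤ h) : slab k h 0 = 0 :=
  slab_of_abs_le hk hkh (by simpa using hk)

theorem abs_slab_le_abs (hk : 0 ≤ k) (hkh : k ≤ h) (s : ℝ) : |slab k h s| ≤ |s| := by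
  simpa [slab_zero hk hkh] using abs_slab_sub_le hk hkh s 0

theorem IsNonlinearity.mul_slab_nonneg {ψ : ℝ → ℝ} (hψ : IsNonlinearity ψ)
    (hk : 0 ≤ k) (hkh : k ≤ h) (s t : ℝ) :
    0 ≤ ψ (s - t) * (slab k h s - slab k h t) := by
  rcases le_total t s with hst | hst
  · exact mul_nonneg (hψ.nonneg (sub_nonneg.2 hst)) (slab_sub_nonneg hk hkh hst)
  · rw [← neg_sub t s, hψ.odd, ← neg_sub (slab k h t), neg_mul_neg]
    exact mul_nonneg (hψ.nonneg (sub_nonneg.2 hst)) (slab_sub_nonneg hk hkh hst)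

/-- A jump across the whole slab contributes at least `c₁ (h - k) ^ p` to the interaction. -/
theorem IsNonlinearity.le_mul_slab {ψ : ℝ → ℝ} (hψ : IsNonlinearity ψ) {p c₁ c₂ : ℝ}
    (hpow : IsPowerLike p c₁ c₂ ψ) (hk : 0 ≤ k) (hkh : k < h) {s t : ℝ}
    (hs : h < |s|) (ht : |t| ≤ k) :
    c₁ * (h - k) ^ p ≤ ψ (s - t) * (slab k h s - slab k h t) := by
  have hd : 0 < h - k := sub_pos.2 hkh
  have key : c₁ * (h - k) ^ p ≤ ψ (h - k) * (h - k) := by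
    have := mul_le_mul_of_nonneg_right (hpow _ hd).1 hd.le
    rwa [mul_assoc, ← Real.rpow_add_one hd.ne', sub_add_cancel] at this
  refine key.trans ?_
  rw [slab_of_abs_le hk hkh.le ht, sub_zero]
  rw [abs_le] at ht
  rcases lt_abs.1 hs with hs | hs
  · rw [slab_of_le hk hkh.le hs.le]
    exact mul_le_mul_of_nonneg_right (hψ.monotone (by linarith)) hd.le
  · rw [slab_of_le_neg hk hkh.le (by linarith), ← neg_sub t s, hψ.odd, neg_mul_neg]
    exact mul_le_mul_of_nonneg_right (hψ.monotone (by linarith)) hd.le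

end slab

/-! ### Stampacchia's lemma -/

/-- Stampacchia's lemma. Since `β > 1`, the inequality improves superlinearly along the levels
`k₀ + d (1 - 2 ^ (-n))`, which forces `a` to vanish at their limit once `d` is large enough for
`V * 2 ^ (-n q / (β - 1))` to propagate as a bound. -/
theorem eq_zero_of_stampacchia {a : ℝ → ℝ} (ha : Antitone a) (ha0 : ∀ k, 0 ≤ a k)
    {k₀ d K V q β : ℝ} (hK : 0 ≤ K) (hV : 0 < V) (hq : 0 < q) (hβ : 1 < β) (hd : 0 < d)
    (hk₀ : a k₀ ≤ V)
    (hstep : ∀ k h, k₀ ≤ k → k < h → a h * (h - k) ^ q ≤ K * a k ^ β)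
    (hdK : K * V ^ (β - 1) * 2 ^ (q * β / (β - 1)) ≤ d ^ q) : a (k₀ + d) = 0 := by
  set μ := q / (β - 1) with hμ
  have hβ' : 0 < β - 1 := sub_pos.2 hβ
  have hμ0 : 0 < μ := div_pos hq hβ'
  have hqμ : q = μ * (β - 1) := by rw [hμ]; field_simp
  set θ : ℝ := 2 ^ (-μ) with hθ
  have hθ0 : 0 < θ := by positivity
  have hθ1 : θ < 1 := Real.rpow_lt_one_of_one_lt_of_neg (by norm_num) (by linarith)
  have hind : ∀ n : ℕ, a (k₀ + d * (1 - (1 / 2) ^ n)) ≤ V * θ ^ n := by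
    intro n
    induction n with
    | zero => simpa using hk₀
    | succ n ih =>
      have h2 : (1 / 2 : ℝ) ^ (n + 1) = (1 / 2) ^ n * (1 / 2) := pow_succ _ _
      have hpos : (0 : ℝ) < (1 / 2) ^ n := by positivity
      have hle1 : (1 / 2 : ℝ) ^ n ≤ 1 := pow_le_one₀ (by norm_num) (by norm_num)
      have hs := hstep (k₀ + d * (1 - (1 / 2) ^ n)) (k₀ + d * (1 - (1 / 2) ^ (n + 1)))
        (by nlinarith) (by rw [h2]; nlinarith)
      have hdiff : k₀ + d * (1 - (1 / 2) ^ (n + 1)) - (k₀ + d * (1 - (1 / 2) ^ n))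
          = d * (1 / 2) ^ (n + 1) := by rw [h2]; ring
      rw [hdiff, Real.mul_rpow hd.le (by positivity)] at hs
      have hs2 : K * a (k₀ + d * (1 - (1 / 2) ^ n)) ^ β ≤ K * (V * θ ^ n) ^ β :=
        mul_le_mul_of_nonneg_left
          (Real.rpow_le_rpow (ha0 _) ih (by linarith)) hK
      have e1 : ((1 / 2 : ℝ) ^ (n + 1)) ^ q = 2 ^ (-(((n : ℝ) + 1) * q)) := by
        rw [one_div, inv_pow, Real.inv_rpow (by positivity), ← Real.rpow_natCast,
          ← Real.rpow_mul (by norm_num), Real.rpow_neg (by norm_num)]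
        push_cast
        rfl
      have e2 : ∀ j : ℕ, θ ^ j = 2 ^ (-(μ * j)) := by
        intro j
        rw [hθ, ← Real.rpow_natCast, ← Real.rpow_mul (by norm_num)]
        congr 1
        ring
      have e3 : K * (V * θ ^ n) ^ β
          = (K * V ^ (β - 1) * 2 ^ (q * β / (β - 1))) * (2 ^ (-(((n : ℝ) + 1) * q)))
            * (V * θ ^ (n + 1)) := by
        rw [Real.mul_rpow hV.le (by positivity), e2, e2, ← Real.rpow_mul (by norm_num)]
        have : V ^ β = V ^ (β - 1) * V := by
          rw [← Real.rpow_add_one hV.ne', sub_add_cancel]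
        rw [this]
        have : (2 : ℝ) ^ (-(μ * n) * β) = 2 ^ (q * β / (β - 1)) * (2 ^ (-(((n : ℝ) + 1) * q)))
            * 2 ^ (-(μ * ((n + 1 : ℕ) : ℝ))) := by
          rw [← Real.rpow_add (by norm_num), ← Real.rpow_add (by norm_num)]
          congr 1
          have : q * β / (β - 1) = μ * β := by rw [hμ]; ring
          rw [this, hqμ]
          push_cast
          ring
        rw [this]
        ring
      rw [e1] at hs
      have hfac : (0 : ℝ) < 2 ^ (-(((n : ℝ) + 1) * q)) := by positivity
      have hdq : 0 < d ^ q := by positivity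
      have hfin := hs.trans (hs2.trans_eq e3)
      have hle : (K * V ^ (β - 1) * 2 ^ (q * β / (β - 1))) * (2 ^ (-(((n : ℝ) + 1) * q)))
            * (V * θ ^ (n + 1)) ≤ d ^ q * (2 ^ (-(((n : ℝ) + 1) * q))) * (V * θ ^ (n + 1)) := by
        gcongr
      have := hfin.trans hle
      rw [mul_comm] at this
      exact le_of_mul_le_mul_left this (mul_pos hdq hfac)
  refine le_antisymm ?_ (ha0 _)
  have hlim : Filter.Tendsto (fun n : ℕ => V * θ ^ n) Filter.atTop (nhds (V * 0)) :=
    (tendsto_pow_atTop_nhds_zero_of_lt_one hθ0.le hθ1).const_mul V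
  rw [mul_zero] at hlim
  refine ge_of_tendsto' hlim fun n => (ha ?_).trans (hind n)
  have : (0 : ℝ) < (1 / 2) ^ n := by positivity
  nlinarith

/-! ### Interaction of a small set with its complement -/

/-- A set `A` no larger than half of the unit ball interacts strongly with its complement: around
any point, the ball of measure `2 |A|` has radius `r ≤ 1` and lies outside `A` by at least half, and
there the kernel is at least `c₀ r ^ (-N - α)`. -/
theorem le_lintegral_kernel {N : ℕ} (hN : 1 ≤ N) {α c₀ : ℝ} (hα : 0 < α) (hc₀ : 0 < c₀)
    {J : EuclideanSpace ℝ (Fin N) → ℝ} (hJ : IsKernel J) (hs : HasSingularity α c₀ J)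
    {A B : Set (EuclideanSpace ℝ (Fin N))} (hA : MeasurableSet A)
    (hB : volume B ≠ ∞) {w : ℝ}
    (hw : w = volume.real (Metric.ball (0 : EuclideanSpace ℝ (Fin N)) 1))
    (hAw : volume A ≤ ENNReal.ofReal (w / 2)) :
    ENNReal.ofReal (c₀ * (w / 2) ^ (1 + α / N) * volume.real A ^ (-(α / N)) * volume.real B) ≤
      ∫⁻ z in B ×ˢ Aᶜ, ENNReal.ofReal (J (z.1 - z.2)) := by
  have : Nonempty (Fin N) := ⟨⟨0, hN⟩⟩
  have hN0 : (0 : ℝ) < N := by exact_mod_cast hN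
  have hAfin : volume A ≠ ∞ := ne_top_of_le_ne_top ENNReal.ofReal_ne_top hAw
  have hwpos : 0 < w := by
    rw [hw]
    exact ENNReal.toReal_pos (Metric.measure_ball_pos _ _ one_pos).ne' measure_ball_lt_top.ne
  set a := volume.real A with ha
  have hVA : volume A = ENNReal.ofReal a := (ENNReal.ofReal_toReal hAfin).symm
  -- If `A` is null, the left-hand side vanishes: a negative power of zero is zero.
  rcases (measureReal_nonneg (μ := volume) (s := A)).eq_or_lt' with h0 | hapos
  · rw [← ha] at h0
    rw [h0, Real.zero_rpow (by have := div_pos hα hN0; linarith)]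
    simp
  rw [← ha] at hapos
  have haw : a ≤ w / 2 := by
    rw [hVA] at hAw
    exact (ENNReal.ofReal_le_ofReal_iff (by positivity)).1 hAw
  set r : ℝ := (2 * a / w) ^ (1 / (N : ℝ)) with hr
  have hbase : 0 < 2 * a / w := by positivity
  have hr0 : 0 < r := by positivity
  have hr1 : r ≤ 1 :=
    Real.rpow_le_one hbase.le ((div_le_one hwpos).2 (by linarith)) (by positivity)
  have hrN : r ^ N = 2 * a / w := by
    rw [hr, ← Real.rpow_natCast, ← Real.rpow_mul hbase.le, one_div_mul_cancel hN0.ne',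
      Real.rpow_one]
  have hball : ∀ x : EuclideanSpace ℝ (Fin N),
      volume (Metric.ball x r) = ENNReal.ofReal (2 * a) := by
    intro x
    rw [Measure.addHaar_ball_of_pos _ _ hr0, finrank_euclideanSpace_fin, hrN,
      ← ENNReal.ofReal_toReal (measure_ball_lt_top
        (x := (0 : EuclideanSpace ℝ (Fin N))) (r := 1)).ne, ← measureReal_def, ← hw,
      ← ENNReal.ofReal_mul hbase.le, div_mul_cancel₀ _ hwpos.ne']
  have hinner : ∀ x : EuclideanSpace ℝ (Fin N),
      ENNReal.ofReal (c₀ * r ^ (-(N : ℝ) - α) * a) ≤ ∫⁻ y in Aᶜ, ENNReal.ofReal (J (x - y)) := by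
    intro x
    -- The value of the kernel at the origin is unknown, so the centre is removed from the ball.
    have hm : ENNReal.ofReal a ≤ volume ((Metric.ball x r \ A) \ {x}) := by
      rw [measure_sdiff_null (measure_singleton x)]
      refine le_trans ?_ le_measure_sdiff
      rw [hball, hVA, ← ENNReal.ofReal_sub _ hapos.le]
      exact ENNReal.ofReal_le_ofReal (by linarith)
    calc ENNReal.ofReal (c₀ * r ^ (-(N : ℝ) - α) * a)
        = ENNReal.ofReal (c₀ * r ^ (-(N : ℝ) - α)) * ENNReal.ofReal a :=
          ENNReal.ofReal_mul (by positivity)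
      _ ≤ ENNReal.ofReal (c₀ * r ^ (-(N : ℝ) - α)) * volume ((Metric.ball x r \ A) \ {x}) := by
          gcongr
      _ = ∫⁻ _ in (Metric.ball x r \ A) \ {x}, ENNReal.ofReal (c₀ * r ^ (-(N : ℝ) - α)) := by
          rw [setLIntegral_const]
      _ ≤ ∫⁻ y in (Metric.ball x r \ A) \ {x}, ENNReal.ofReal (J (x - y)) := by
          refine setLIntegral_mono' ((measurableSet_ball.diff hA).diff
            (measurableSet_singleton x)) fun y hy => ENNReal.ofReal_le_ofReal ?_
          have hy0 : 0 < ‖x - y‖ := by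
            rw [norm_pos_iff, sub_ne_zero]
            exact fun h => hy.2 h.symm
          have hyr : ‖x - y‖ < r := by
            rw [← dist_eq_norm, dist_comm]
            exact hy.1.1
          refine le_trans ?_ (hs _ hy0 (hyr.trans_le hr1))
          exact mul_le_mul_of_nonneg_left
            (Real.rpow_le_rpow_of_nonpos hy0 hyr.le (by linarith)) hc₀.le
      _ ≤ ∫⁻ y in Aᶜ, ENNReal.ofReal (J (x - y)) :=
          lintegral_mono_set fun y hy => hy.1.2
  have hmeas : Measurable fun z : EuclideanSpace ℝ (Fin N) × EuclideanSpace ℝ (Fin N) =>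
      ENNReal.ofReal (J (z.1 - z.2)) :=
    (hJ.measurable.comp (measurable_fst.sub measurable_snd)).ennreal_ofReal
  have hconst : c₀ * r ^ (-(N : ℝ) - α) * a = c₀ * (w / 2) ^ (1 + α / N) * a ^ (-(α / N)) := by
    have h1 : r ^ (-(N : ℝ) - α) = (2 * a / w) ^ (-(1 + α / N)) := by
      rw [hr, ← Real.rpow_mul hbase.le]
      congr 1
      field_simp
      ring
    have h2 : 2 * a / w = (w / 2)⁻¹ * a := by field_simp
    rw [h1, h2, Real.mul_rpow (by positivity) hapos.le, Real.rpow_neg (by positivity),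
      Real.inv_rpow (by positivity), inv_inv]
    have h3 : a ^ (-(α / N)) = a ^ (-(1 + α / N)) * a := by
      rw [← Real.rpow_add_one hapos.ne']
      congr 1
      ring
    rw [h3]
    ring
  rw [Measure.volume_eq_prod, setLIntegral_prod _ hmeas.aemeasurable, ← hconst,
    ENNReal.ofReal_mul (by positivity), measureReal_def, ENNReal.ofReal_toReal hB,
    ← setLIntegral_const]
  exact lintegral_mono fun x => hinner x

/-! ### Energy and superlevel sets -/

/-- Chaining: a function vanishing off a set that the translation by `M • e` pushes off itself can
only be larger than `k` where one of the `M` steps of length `e` makes a jump larger than `k / M`.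
-/
theorem volume_superlevel_le {N : ℕ} {Ω : Set (EuclideanSpace ℝ (Fin N))}
    {u : EuclideanSpace ℝ (Fin N) → ℝ} (hu0 : ∀ x, x ∉ Ω → u x = 0)
    {M : ℕ} (hM : 0 < M) {e : EuclideanSpace ℝ (Fin N)} (he : ∀ x ∈ Ω, x - (M : ℝ) • e ∉ Ω)
    {k : ℝ} (hk : 0 ≤ k) :
    volume {x | k < |u x|} ≤ M * volume {x | k / M < |u x - u (x - e)|} := by
  set D := {x | k / M < |u x - u (x - e)|} with hD
  have hM0 : (0 : ℝ) < M := by exact_mod_cast hM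
  have hsub : {x | k < |u x|} ⊆ ⋃ i ∈ Finset.range M, (fun x => x - (i : ℝ) • e) ⁻¹' D := by
    intro x hx
    by_contra hcon
    simp only [mem_iUnion, not_exists, mem_preimage, hD, mem_ofPred_eq, not_lt,
      Finset.mem_range] at hcon
    have hxΩ : x ∈ Ω := by
      by_contra h
      rw [mem_ofPred_eq, hu0 x h, abs_zero] at hx
      linarith
    have htel : u x = ∑ i ∈ Finset.range M,
        (u (x - (i : ℝ) • e) - u (x - ((i + 1 : ℕ) : ℝ) • e)) := by
      rw [Finset.sum_range_sub' (fun i : ℕ => u (x - (i : ℝ) • e)), hu0 _ (he x hxΩ)]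
      simp
    have : |u x| ≤ k := by
      rw [htel]
      refine (Finset.abs_sum_le_sum_abs _ _).trans ?_
      calc _ ≤ ∑ _i ∈ Finset.range M, k / M := by
            refine Finset.sum_le_sum fun i hi => ?_
            have := hcon i (Finset.mem_range.1 hi)
            have hstep : (i : ℝ) • e + e = ((i + 1 : ℕ) : ℝ) • e := by
              rw [Nat.cast_succ, add_smul, one_smul]
            rwa [sub_sub, hstep] at this
        _ = k := by
            rw [Finset.sum_const, Finset.card_range, nsmul_eq_mul, mul_div_cancel₀ _ hM0.ne']
    exact absurd hx (not_lt.2 this)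
  calc volume {x | k < |u x|} ≤ ∑ i ∈ Finset.range M,
        volume ((fun x => x - (i : ℝ) • e) ⁻¹' D) :=
        (measure_mono hsub).trans (measure_biUnion_finset_le _ _)
    _ = ∑ _i ∈ Finset.range M, volume D := by
        refine Finset.sum_congr rfl fun i _ => ?_
        simp only [sub_eq_add_neg]
        exact measure_preimage_add_right _ _ _
    _ = M * volume D := by simp

/-- The density of the energy, in the variables `x` and `e = x - y`. -/
theorem two_mul_energy {N : ℕ} {ψ : ℝ → ℝ} (hψ : IsNonlinearity ψ)
    {J : EuclideanSpace ℝ (Fin N) → ℝ} (hJ : IsKernel J)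
    {u : EuclideanSpace ℝ (Fin N) → ℝ} (hu : Measurable u) :
    2 * energy ψ J u = ∫⁻ e, ∫⁻ x, ENNReal.ofReal (primitive ψ (u x - u (x - e)) * J e) := by
  have hmeas : Measurable fun z : EuclideanSpace ℝ (Fin N) × EuclideanSpace ℝ (Fin N) =>
      ENNReal.ofReal (primitive ψ (u z.1 - u z.2) * J (z.1 - z.2)) :=
    ((hψ.continuous_primitive.measurable.comp
      ((hu.comp measurable_fst).sub (hu.comp measurable_snd))).mul
      (hJ.measurable.comp (measurable_fst.sub measurable_snd))).ennreal_ofReal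
  have hmeas' : Measurable fun z : EuclideanSpace ℝ (Fin N) × EuclideanSpace ℝ (Fin N) =>
      ENNReal.ofReal (primitive ψ (u z.1 - u (z.1 - z.2)) * J z.2) :=
    ((hψ.continuous_primitive.measurable.comp
      ((hu.comp measurable_fst).sub (hu.comp (measurable_fst.sub measurable_snd)))).mul
      (hJ.measurable.comp measurable_snd)).ennreal_ofReal
  rw [energy, ← mul_assoc, ENNReal.mul_inv_cancel (by norm_num) (by norm_num), one_mul,
    Measure.volume_eq_prod, lintegral_prod _ hmeas.aemeasurable,
    ← lintegral_lintegral_swap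
      (f := fun x e => ENNReal.ofReal (primitive ψ (u x - u (x - e)) * J e))
      hmeas'.aemeasurable]
  refine lintegral_congr fun x => ?_
  rw [← lintegral_sub_left_eq_self _ x]
  simp

/-- A Poincaré inequality in weak form: the energy controls the measure of superlevel sets. -/
theorem exists_volume_superlevel_le {N : ℕ} (hN : 1 ≤ N)
    {Ω : Set (EuclideanSpace ℝ (Fin N))} (hΩb : Bornology.IsBounded Ω)
    {p : ℝ} (hp : 1 < p) {c₁ : ℝ} (hc₁ : 0 < c₁)
    {α c₀ : ℝ} (hα : 0 < α) (hc₀ : 0 < c₀) :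
    ∃ C : ℝ, 0 < C ∧ ∀ (ψ : ℝ → ℝ) (c₂ : ℝ), IsNonlinearity ψ → IsPowerLike p c₁ c₂ ψ →
      ∀ J : EuclideanSpace ℝ (Fin N) → ℝ, IsKernel J → HasSingularity α c₀ J →
      ∀ u : EuclideanSpace ℝ (Fin N) → ℝ, Measurable u → (∀ x, x ∉ Ω → u x = 0) →
      ∀ k : ℝ, 0 ≤ k →
        ENNReal.ofReal (k ^ p) * volume {x | k < |u x|} ≤ ENNReal.ofReal C * energy ψ J u := by
  have : Nonempty (Fin N) := ⟨⟨0, hN⟩⟩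
  obtain ⟨R, hR⟩ := hΩb.subset_closedBall (0 : EuclideanSpace ℝ (Fin N))
  obtain ⟨M, hM⟩ := exists_nat_gt (max 1 (4 * R))
  have hM1 : (1 : ℝ) < M := (le_max_left _ _).trans_lt hM
  have hMR : 4 * R < M := (le_max_right _ _).trans_lt hM
  have hM0 : 0 < M := by exact_mod_cast (zero_lt_one.trans hM1)
  set S : Set (EuclideanSpace ℝ (Fin N)) := {e | 1 / 2 < ‖e‖ ∧ ‖e‖ < 1} with hS
  have hSo : IsOpen S :=
    (isOpen_lt continuous_const continuous_norm).inter (isOpen_lt continuous_norm continuous_const)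
  have hSne : S.Nonempty := by
    obtain ⟨e, he⟩ := exists_norm_eq (EuclideanSpace ℝ (Fin N))
      (c := (3 / 4 : ℝ)) (by norm_num)
    exact ⟨e, by rw [hS, mem_ofPred_eq, he]; norm_num⟩
  have hSfin : volume S ≠ ∞ :=
    ne_top_of_le_ne_top (measure_ball_lt_top (x := (0 : EuclideanSpace ℝ (Fin N))) (r := 1)).ne
      (measure_mono fun e he => by simpa using he.2)
  set s := volume.real S with hs
  have hs0 : 0 < s := ENNReal.toReal_pos (hSo.measure_pos volume hSne).ne' hSfin
  have hMr : (0 : ℝ) < M := by linarith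
  refine ⟨2 * M * (M ^ p * p / (c₁ * c₀ * s)), by positivity, ?_⟩
  intro ψ c₂ hψ hpow J hJ hsing u hu hu0 k hk
  set A := volume {x | k < |u x|}
  have hesc : ∀ e ∈ S, ∀ x ∈ Ω, x - (M : ℝ) • e ∉ Ω := by
    intro e he x hx hcon
    have h1 := hR hx
    have h2 := hR hcon
    rw [mem_closedBall_zero_iff] at h1 h2
    have h3 : ‖(M : ℝ) • e‖ ≤ ‖x‖ + ‖x - (M : ℝ) • e‖ := by
      simpa using norm_sub_le x (x - (M : ℝ) • e)
    rw [norm_smul, Real.norm_natCast] at h3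
    have := mul_lt_mul_of_pos_left he.1 hMr
    linarith
  have hone : ∀ e ∈ S, ENNReal.ofReal (c₁ / p * (k / M) ^ p * c₀) * A ≤
      M * ∫⁻ x, ENNReal.ofReal (primitive ψ (u x - u (x - e)) * J e) := by
    intro e he
    have hJe : c₀ ≤ J e := by
      refine le_trans ?_ (hsing e (by linarith [he.1]) he.2)
      refine le_mul_of_one_le_right hc₀.le ?_
      exact Real.one_le_rpow_of_pos_of_le_one_of_nonpos (by linarith [he.1]) he.2.le
        (by have : (0 : ℝ) ≤ N := N.cast_nonneg
            linarith)
    calc ENNReal.ofReal (c₁ / p * (k / M) ^ p * c₀) * A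
        ≤ ENNReal.ofReal (c₁ / p * (k / M) ^ p * c₀) *
            (M * volume {x | k / M < |u x - u (x - e)|}) := by
          gcongr
          exact volume_superlevel_le hu0 hM0 (hesc e he) hk
      _ = M * (ENNReal.ofReal (c₁ / p * (k / M) ^ p * c₀) *
            volume {x | k / M < |u x - u (x - e)|}) := by ring
      _ = M * ∫⁻ _ in {x | k / M < |u x - u (x - e)|},
            ENNReal.ofReal (c₁ / p * (k / M) ^ p * c₀) := by rw [setLIntegral_const]
      _ ≤ M * ∫⁻ x in {x | k / M < |u x - u (x - e)|},
            ENNReal.ofReal (primitive ψ (u x - u (x - e)) * J e) := by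
          refine mul_le_mul_right (setLIntegral_mono' (measurableSet_lt measurable_const
            (hu.sub (hu.comp (measurable_id.sub_const e))).abs) fun x hx => ?_) _
          have hkM : 0 ≤ k / M := by positivity
          refine ENNReal.ofReal_le_ofReal (mul_le_mul ?_ hJe hc₀.le (hψ.primitive_nonneg _))
          refine (hψ.le_primitive hp hpow hkM).trans (hψ.primitive_mono ?_)
          rw [abs_of_nonneg hkM]
          exact (show k / M < |u x - u (x - e)| from hx).le
      _ ≤ _ := by
          exact mul_le_mul_right (setLIntegral_le_lintegral _ _) _
  have hsum : ENNReal.ofReal (c₁ / p * (k / M) ^ p * c₀) * A * volume S ≤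
      M * (2 * energy ψ J u) := by
    rw [two_mul_energy hψ hJ hu, ← setLIntegral_const, ← lintegral_const_mul' _ _ (by simp)]
    exact (setLIntegral_mono' hSo.measurableSet hone).trans (setLIntegral_le_lintegral _ _)
  have hVS : volume S = ENNReal.ofReal s := (ENNReal.ofReal_toReal hSfin).symm
  have hid : k ^ p = M ^ p * p / (c₁ * c₀ * s) * (c₁ / p * (k / M) ^ p * c₀ * s) := by
    rw [Real.div_rpow hk hMr.le]
    have : (M : ℝ) ^ p ≠ 0 := by positivity
    have : p ≠ 0 := by positivity
    field_simp
  calc ENNReal.ofReal (k ^ p) * A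
      = ENNReal.ofReal (M ^ p * p / (c₁ * c₀ * s)) *
          (ENNReal.ofReal (c₁ / p * (k / M) ^ p * c₀) * A * volume S) := by
        rw [hid, ENNReal.ofReal_mul (by positivity), ENNReal.ofReal_mul (q := s) (by positivity),
          hVS]
        ring
    _ ≤ ENNReal.ofReal (M ^ p * p / (c₁ * c₀ * s)) * (M * (2 * energy ψ J u)) := by gcongr
    _ = _ := by
        rw [ENNReal.ofReal_mul (p := 2 * (M : ℝ)) (by positivity), ENNReal.ofReal_mul zero_le_two,
          ENNReal.ofReal_natCast, ENNReal.ofReal_ofNat]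
        ring

/-! ### Weak solutions and truncated test functions -/

section WeakSolution

variable {N : ℕ} {ψ : ℝ → ℝ} {J : EuclideanSpace ℝ (Fin N) → ℝ}
  {Ω : Set (EuclideanSpace ℝ (Fin N))} {f u v : EuclideanSpace ℝ (Fin N) → ℝ}

theorem ae_eq_fst_snd (h : u =ᵐ[volume] v) :
    ∀ᵐ z : EuclideanSpace ℝ (Fin N) × EuclideanSpace ℝ (Fin N),
      u z.1 = v z.1 ∧ u z.2 = v z.2 :=
  (Measure.quasiMeasurePreserving_fst.ae_eq h).and (Measure.quasiMeasurePreserving_snd.ae_eq h)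

theorem energy_congr_ae (h : u =ᵐ[volume] v) : energy ψ J u = energy ψ J v := by
  rw [energy, energy]
  congr 1
  refine lintegral_congr_ae ?_
  filter_upwards [ae_eq_fst_snd h] with z hz
  rw [hz.1, hz.2]

theorem interactionDensity_congr_ae (h : u =ᵐ[volume] v) (φ : EuclideanSpace ℝ (Fin N) → ℝ) :
    interactionDensity ψ J u φ =ᵐ[volume] interactionDensity ψ J v φ := by
  filter_upwards [ae_eq_fst_snd h] with z hz
  rw [interactionDensity, interactionDensity, hz.1, hz.2]

theorem MemW₀.congr_ae (hu : MemW₀ ψ J Ω u) (h : u =ᵐ[volume] v) : MemW₀ ψ J Ω v where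
  aemeasurable := hu.aemeasurable.congr h
  modular_lt_top := by
    have : modular ψ v = modular ψ u := lintegral_congr_ae (h.mono fun x hx => by simp only [hx])
    exact this ▸ hu.modular_lt_top
  energy_lt_top := energy_congr_ae (ψ := ψ) (J := J) h ▸ hu.energy_lt_top
  eq_zero := by
    filter_upwards [hu.eq_zero, h] with x hx hxv hxΩ
    rw [← hxv, hx hxΩ]

theorem IsWeakSolution.congr_ae (hu : IsWeakSolution ψ J Ω f u) (h : u =ᵐ[volume] v) :
    IsWeakSolution ψ J Ω f v where
  mem := hu.mem.congr_ae h
  integrable_density φ hφ :=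
    (hu.integrable_density φ hφ).congr (interactionDensity_congr_ae h φ)
  integrable_pairing := hu.integrable_pairing
  eq φ hφ := by
    rw [← hu.eq φ hφ, interaction, interaction,
      integral_congr_ae (interactionDensity_congr_ae (ψ := ψ) (J := J) h φ)]

/-- Truncations of elements of `W₀` are admissible test functions. -/
theorem MemW₀.slab_comp (hψ : IsNonlinearity ψ) (hJ : IsKernel J) (hu : MemW₀ ψ J Ω u)
    {k h : ℝ} (hk : 0 ≤ k) (hkh : k ≤ h) : MemW₀ ψ J Ω fun x => slab k h (u x) where
  aemeasurable := (continuous_slab k h).measurable.comp_aemeasurable hu.aemeasurable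
  modular_lt_top := (lintegral_mono fun x => ENNReal.ofReal_le_ofReal
    (hψ.primitive_mono (abs_slab_le_abs hk hkh (u x)))).trans_lt hu.modular_lt_top
  energy_lt_top := by
    refine lt_of_le_of_lt ?_ hu.energy_lt_top
    rw [energy, energy]
    refine mul_le_mul_right (lintegral_mono fun z => ENNReal.ofReal_le_ofReal ?_) _
    -- The sign of `J 0` is unknown, but both sides vanish on the diagonal.
    rcases eq_or_ne (z.1 - z.2) 0 with hz | hz
    · rw [sub_eq_zero.1 hz]
      simp [primitive_zero]
    · exact mul_le_mul_of_nonneg_right (hψ.primitive_mono (abs_slab_sub_le hk hkh _ _))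
        (hJ.pos _ hz).le
  eq_zero := hu.eq_zero.mono fun x hx hxΩ => by rw [hx hxΩ, slab_zero hk hkh]

/-- On `{h < |u|} × {k < |u|}ᶜ` the function jumps by at least `h - k`, whence a lower bound for the
energy. -/
theorem le_energy_of_jump (hψ : IsNonlinearity ψ) (hJ : IsKernel J) {p c₁ c₂ : ℝ} (hp : 1 < p)
    (hc₁ : 0 < c₁) (hpow : IsPowerLike p c₁ c₂ ψ) (hu : Measurable u) {k h : ℝ} (hkh : k < h) :
    ENNReal.ofReal (c₁ / p * (h - k) ^ p) *
      ∫⁻ z in {x | h < |u x|} ×ˢ {x | k < |u x|}ᶜ, ENNReal.ofReal (J (z.1 - z.2)) ≤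
        2 * energy ψ J u := by
  have hd : 0 < h - k := sub_pos.2 hkh
  have hms : ∀ k, MeasurableSet {x | k < |u x|} := fun k => measurableSet_lt measurable_const hu.abs
  rw [energy, ← mul_assoc, ENNReal.mul_inv_cancel (by norm_num) (by norm_num), one_mul,
    ← lintegral_const_mul' _ _ ENNReal.ofReal_ne_top]
  refine le_trans ?_ (setLIntegral_le_lintegral ({x | h < |u x|} ×ˢ {x | k < |u x|}ᶜ) _)
  refine setLIntegral_mono' ((hms h).prod (hms k).compl) fun z hz => ?_
  have h1 : h < |u z.1| := hz.1
  have h2 : |u z.2| ≤ k := not_lt.1 hz.2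
  have hne : z.1 - z.2 ≠ 0 := by
    intro h0
    rw [sub_eq_zero.1 h0] at h1
    linarith
  rw [← ENNReal.ofReal_mul (by positivity)]
  refine ENNReal.ofReal_le_ofReal (mul_le_mul_of_nonneg_right ?_ (hJ.pos _ hne).le)
  refine (hψ.le_primitive hp hpow hd.le).trans (hψ.primitive_mono ?_)
  rw [abs_of_pos hd]
  linarith [abs_sub_abs_le_abs_sub (u z.1) (u z.2)]

/-- The analogue of `le_energy_of_jump` for the interaction of `u` with its slab truncation, whose
density is nonnegative everywhere. -/
theorem le_integral_interactionDensity_of_jump (hψ : IsNonlinearity ψ) (hJ : IsKernel J)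
    {p c₁ c₂ : ℝ} (hc₁ : 0 < c₁) (hpow : IsPowerLike p c₁ c₂ ψ) (hu : Measurable u)
    {k h : ℝ} (hk : 0 ≤ k) (hkh : k < h)
    (hint : Integrable (interactionDensity ψ J u fun x => slab k h (u x))) :
    ENNReal.ofReal (c₁ * (h - k) ^ p) *
      ∫⁻ z in {x | h < |u x|} ×ˢ {x | k < |u x|}ᶜ, ENNReal.ofReal (J (z.1 - z.2)) ≤
        ENNReal.ofReal (∫ z, interactionDensity ψ J u (fun x => slab k h (u x)) z) := by
  have hd : 0 < h - k := sub_pos.2 hkh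
  have hms : ∀ k, MeasurableSet {x | k < |u x|} := fun k => measurableSet_lt measurable_const hu.abs
  have hnn : ∀ z, 0 ≤ interactionDensity ψ J u (fun x => slab k h (u x)) z := by
    intro z
    rw [interactionDensity]
    rcases eq_or_ne (z.1 - z.2) 0 with hz | hz
    · rw [sub_eq_zero.1 hz]
      simp
    · exact mul_nonneg (hψ.mul_slab_nonneg hk hkh.le _ _) (hJ.pos _ hz).le
  rw [ofReal_integral_eq_lintegral_ofReal hint (Filter.Eventually.of_forall hnn),
    ← lintegral_const_mul' _ _ ENNReal.ofReal_ne_top]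
  refine le_trans ?_ (setLIntegral_le_lintegral ({x | h < |u x|} ×ˢ {x | k < |u x|}ᶜ) _)
  refine setLIntegral_mono' ((hms h).prod (hms k).compl) fun z hz => ?_
  have h1 : h < |u z.1| := hz.1
  have h2 : |u z.2| ≤ k := not_lt.1 hz.2
  have hne : z.1 - z.2 ≠ 0 := by
    intro h0
    rw [sub_eq_zero.1 h0] at h1
    linarith
  rw [← ENNReal.ofReal_mul (by positivity), interactionDensity]
  exact ENNReal.ofReal_le_ofReal (mul_le_mul_of_nonneg_right
    (hψ.le_mul_slab hpow hk hkh h1 h2) (hJ.pos _ hne).le)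

/-- Hölder's inequality for the right-hand side tested with a slab truncation. -/
theorem ofReal_integral_mul_slab_le {m : ℝ≥0∞} (hm : 1 ≤ m)
    (hf : MemLp f m (volume.restrict Ω)) (hu : Measurable u) {k h : ℝ} (hk : 0 ≤ k) (hkh : k ≤ h) :
    ENNReal.ofReal (∫ x in Ω, f x * slab k h (u x)) ≤
      ENNReal.ofReal (h - k) * (eLpNorm f m (volume.restrict Ω) *
        volume {x | k < |u x|} ^ (1 - 1 / m.toReal)) := by
  set A := {x | k < |u x|} with hA
  have hAm : MeasurableSet A := measurableSet_lt measurable_const hu.abs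
  have hexp : 0 ≤ 1 - 1 / m.toReal := by
    rcases eq_or_ne m ∞ with rfl | hmt
    · simp
    · have : 1 ≤ m.toReal := by simpa using ENNReal.toReal_mono hmt hm
      exact sub_nonneg.2 ((div_le_one (by linarith)).2 this)
  calc ENNReal.ofReal (∫ x in Ω, f x * slab k h (u x))
      ≤ ‖∫ x in Ω, f x * slab k h (u x)‖ₑ := by
        rw [← ofReal_norm]
        exact ENNReal.ofReal_le_ofReal (Real.le_norm_self _)
    _ ≤ ∫⁻ x in Ω, ‖f x * slab k h (u x)‖ₑ := enorm_integral_le_lintegral_enorm _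
    _ ≤ ∫⁻ x in Ω, A.indicator (fun x => ENNReal.ofReal (h - k) * ‖f x‖ₑ) x := by
        refine lintegral_mono fun x => ?_
        by_cases hx : x ∈ A
        · rw [indicator_of_mem hx, enorm_mul, mul_comm, ← ofReal_norm (slab k h (u x))]
          gcongr
          exact abs_slab_le hk hkh _
        · rw [slab_of_abs_le hk hkh (not_lt.1 hx)]
          simp
    _ = ENNReal.ofReal (h - k) * eLpNorm f 1 ((volume.restrict Ω).restrict A) := by
        rw [lintegral_indicator hAm, lintegral_const_mul' _ _ ENNReal.ofReal_ne_top,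
          eLpNorm_one_eq_lintegral_enorm]
    _ ≤ _ := by
        refine mul_le_mul_right ?_ _
        refine (eLpNorm_le_eLpNorm_mul_rpow_measure_univ hm
          hf.aestronglyMeasurable.restrict).trans ?_
        rw [Measure.restrict_apply_univ, ENNReal.toReal_one, div_one]
        exact mul_le_mul' (eLpNorm_mono_measure _ Measure.restrict_le_self)
          (ENNReal.rpow_le_rpow (Measure.restrict_apply_le _ _) hexp)

end WeakSolution

/-! ### Decay of superlevel sets -/

/-- Solves the inequality between the measures `a` and `b` of two superlevel sets for `b`. -/
theorem mul_le_of_mul_rpow_neg_le {a b t L R θ γ : ℝ} (ha : 0 ≤ a) (hb : 0 ≤ b) (hba : b ≤ a)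
    (hL : 0 < L) (hθ : 0 < θ) (hγ : 0 ≤ γ)
    (h : L * t * a ^ (-θ) * b ≤ R * a ^ γ) : b * t ≤ L⁻¹ * R * a ^ (γ + θ) := by
  rcases ha.eq_or_lt' with h0 | ha
  · have : b = 0 := le_antisymm (h0 ▸ hba) hb
    rw [this, h0, Real.zero_rpow (by linarith)]
    simp
  · have hpos : 0 < a ^ θ := Real.rpow_pos_of_pos ha θ
    have h1 : a ^ (-θ) * a ^ θ = 1 := by
      rw [← Real.rpow_add ha, neg_add_cancel, Real.rpow_zero]
    have h2 := mul_le_mul_of_nonneg_left h (mul_pos (inv_pos.2 hL) hpos).le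
    calc b * t = L⁻¹ * a ^ θ * (L * t * a ^ (-θ) * b) := by
          have : L⁻¹ * a ^ θ * (L * t * a ^ (-θ) * b)
            = (L⁻¹ * L) * (a ^ (-θ) * a ^ θ) * (b * t) := by ring
          rw [this, h1, inv_mul_cancel₀ hL.ne']
          ring
      _ ≤ _ := h2
      _ = _ := by
          rw [Real.rpow_add ha]
          ring

/-- The conclusion of Stampacchia's lemma for the superlevel sets of a function. -/
theorem ae_abs_le_of_stampacchia {N : ℕ} {u : EuclideanSpace ℝ (Fin N) → ℝ}
    {k₀ L X V q β ε : ℝ} (hfin : volume {x | 0 < |u x|} ≠ ∞) (hk₀ : 0 ≤ k₀)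
    (hL : 0 ≤ L) (hX : 0 ≤ X) (hV : 0 < V) (hq : 0 < q)
    (hβ : 1 < β) (hε : 0 < ε) (hsmall : volume {x | k₀ < |u x|} ≤ ENNReal.ofReal V)
    (hstep : ∀ k h, k₀ ≤ k → k < h → volume.real {x | h < |u x|} * (h - k) ^ q ≤
      L * X * volume.real {x | k < |u x|} ^ β) :
    ∀ᵐ x, |u x| ≤
      k₀ + (L * V ^ (β - 1) * 2 ^ (q * β / (β - 1))) ^ (1 / q) * X ^ (1 / q) + ε := by
  -- Finiteness is only known for nonnegative levels, hence the positive part.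
  have hfin' : ∀ k : ℝ, volume {x | max k 0 < |u x|} ≠ ∞ := fun k =>
    ne_top_of_le_ne_top hfin (measure_mono fun x hx => (le_max_right k 0).trans_lt hx)
  set Q := L * V ^ (β - 1) * 2 ^ (q * β / (β - 1)) with hQ
  have hQ0 : 0 ≤ Q := by positivity
  have hd0 : 0 ≤ Q ^ (1 / q) * X ^ (1 / q) := by positivity
  have hz := eq_zero_of_stampacchia (a := fun k => volume.real {x | max k 0 < |u x|})
    (k₀ := k₀) (d := Q ^ (1 / q) * X ^ (1 / q) + ε) (K := L * X) (V := V) (q := q) (β := β)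
    (fun k h hkh => measureReal_mono
      (fun x hx => (max_le_max_right 0 hkh).trans_lt hx) (hfin' k))
    (fun _ => measureReal_nonneg) (by positivity) hV hq hβ (by positivity)
    (by
      simp only [max_eq_left hk₀]
      exact ENNReal.toReal_le_of_le_ofReal hV.le hsmall)
    (fun k h hk hkh => by
      simp only [max_eq_left (hk₀.trans hk), max_eq_left (hk₀.trans (hk.trans hkh.le))]
      exact hstep k h hk hkh)
    (by
      calc L * X * V ^ (β - 1) * 2 ^ (q * β / (β - 1)) = Q * X := by rw [hQ]; ring
        _ = (Q ^ (1 / q) * X ^ (1 / q)) ^ q := by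
            rw [← Real.mul_rpow hQ0 hX, ← Real.rpow_mul (by positivity), one_div_mul_cancel hq.ne',
              Real.rpow_one]
        _ ≤ _ := Real.rpow_le_rpow hd0 (by linarith) hq.le)
  have hnull := (measureReal_eq_zero_iff (hfin' _)).1 hz
  rw [max_eq_left (by positivity), ← add_assoc] at hnull
  rw [ae_iff]
  simpa only [not_le] using hnull

/-- The level-set iteration. For `m ≥ 1` it runs on the equation tested with slab truncations. For
`m < 1` necessarily `α > N`, so that the energy alone gives a decay with exponent `α / N > 1`. -/
theorem exists_ae_abs_le {N : ℕ} (hN : 1 ≤ N) {Ω : Set (EuclideanSpace ℝ (Fin N))}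
    (hΩb : Bornology.IsBounded Ω) {p : ℝ} (hp : 1 < p) {c₁ : ℝ} (hc₁ : 0 < c₁)
    {α c₀ : ℝ} (hα : 0 < α) (hc₀ : 0 < c₀)
    {m : ℝ≥0∞} (hm : ENNReal.ofReal (N / α) < m)
    {w : ℝ} (hw : w = volume.real (Metric.ball (0 : EuclideanSpace ℝ (Fin N)) 1)) :
    ∃ C : ℝ, 0 ≤ C ∧ ∀ (ψ : ℝ → ℝ) (c₂ : ℝ), IsNonlinearity ψ → IsPowerLike p c₁ c₂ ψ →
      ∀ J : EuclideanSpace ℝ (Fin N) → ℝ, IsKernel J → HasSingularity α c₀ J →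
      ∀ f : EuclideanSpace ℝ (Fin N) → ℝ, MemLp f m (volume.restrict Ω) →
      ∀ u : EuclideanSpace ℝ (Fin N) → ℝ, Measurable u → (∀ x, x ∉ Ω → u x = 0) →
      IsWeakSolution ψ J Ω f u →
      ∀ k₀ : ℝ, 0 ≤ k₀ → volume {x | k₀ < |u x|} ≤ ENNReal.ofReal (w / 2) →
      ∀ ε : ℝ, 0 < ε → ∀ᵐ x, |u x| ≤ k₀ + C * ((energy ψ J u).toReal ^ (1 / p) +
        (eLpNorm f m (volume.restrict Ω)).toReal ^ (1 / (p - 1))) + ε := by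
  have hN0 : (0 : ℝ) < N := by exact_mod_cast hN
  have hwpos : 0 < w := by
    rw [hw]
    exact ENNReal.toReal_pos (Metric.measure_ball_pos _ _ one_pos).ne' measure_ball_lt_top.ne
  have hθ : 0 < α / N := div_pos hα hN0
  set κ := c₀ * (w / 2) ^ (1 + α / N) with hκ
  have hκ0 : 0 < κ := by positivity
  have hfin : ∀ u : EuclideanSpace ℝ (Fin N) → ℝ, (∀ x, x ∉ Ω → u x = 0) → ∀ k : ℝ, 0 ≤ k →
      volume {x | k < |u x|} ≠ ∞ := fun u hu0 k hk =>
    ne_top_of_le_ne_top hΩb.measure_lt_top.ne (measure_mono fun x hx => by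
      by_contra h
      rw [mem_ofPred_eq, hu0 x h, abs_zero] at hx
      linarith)
  rcases le_or_gt 1 m with h1m | hm1
  · set γ := 1 - 1 / m.toReal with hγ
    have hγ0 : 0 ≤ γ ∧ 1 < γ + α / N := by
      rcases eq_or_ne m ∞ with rfl | hmt
      · simp [hγ, hθ]
      · have h1 : 1 ≤ m.toReal := by simpa using ENNReal.toReal_mono hmt h1m
        have h2 : N / α < m.toReal := (ENNReal.ofReal_lt_iff_lt_toReal (by positivity) hmt).1 hm
        refine ⟨sub_nonneg.2 ((div_le_one (by linarith)).2 h1), ?_⟩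
        have : 1 / m.toReal < α / N := by
          rw [div_lt_iff₀ hα] at h2
          rw [div_lt_div_iff₀ (by linarith) hN0]
          linarith
        linarith
    refine ⟨((c₁ * κ)⁻¹ * 2 * (w / 2) ^ (γ + α / N - 1) *
      2 ^ ((p - 1) * (γ + α / N) / (γ + α / N - 1))) ^ (1 / (p - 1)), by positivity, ?_⟩
    intro ψ c₂ hψ hpow J hJ hsing f hf u hu hu0 hsol k₀ hk₀ hsmall ε hε
    set F := (eLpNorm f m (volume.restrict Ω)).toReal with hF
    have hF0 : 0 ≤ F := ENNReal.toReal_nonneg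
    have hstep : ∀ k h, k₀ ≤ k → k < h → volume.real {x | h < |u x|} * (h - k) ^ (p - 1) ≤
        (c₁ * κ)⁻¹ * 2 * F * volume.real {x | k < |u x|} ^ (γ + α / N) := by
      intro k h hk hkh
      have hk0 := hk₀.trans hk
      have hd : 0 < h - k := sub_pos.2 hkh
      have hφ := hsol.mem.slab_comp hψ hJ hk0 hkh.le
      have hA := hfin u hu0 k hk0
      have hB := hfin u hu0 h (hk0.trans hkh.le)
      have e1 := le_lintegral_kernel hN hα hc₀ hJ hsing
        (measurableSet_lt (measurable_const (a := k)) hu.abs) hB hw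
        ((measure_mono fun x hx => hk.trans_lt hx).trans hsmall)
      have e2 := le_integral_interactionDensity_of_jump hψ hJ hc₁ hpow hu hk0 hkh
        (hsol.integrable_density _ hφ)
      have e3 := ofReal_integral_mul_slab_le h1m hf hu hk0 hkh.le
      have e4 : ∫ z, interactionDensity ψ J u (fun x => slab k h (u x)) z =
          2 * ∫ x in Ω, f x * slab k h (u x) := by
        rw [← hsol.eq _ hφ, interaction, mul_inv_cancel_left₀ two_ne_zero]
      rw [e4, ENNReal.ofReal_mul zero_le_two] at e2
      have e5 := ((mul_le_mul_right e1 _).trans e2).trans (mul_le_mul_right e3 _)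
      rw [← ENNReal.ofReal_mul (by positivity), ← ENNReal.ofReal_toReal hf.eLpNorm_ne_top,
        ← ENNReal.ofReal_toReal hA, ENNReal.ofReal_rpow_of_nonneg ENNReal.toReal_nonneg hγ0.1,
        ← ENNReal.ofReal_mul ENNReal.toReal_nonneg, ← ENNReal.ofReal_mul hd.le,
        ← ENNReal.ofReal_mul zero_le_two, ENNReal.ofReal_le_ofReal_iff (by positivity)] at e5
      refine (mul_le_of_mul_rpow_neg_le (a := volume.real {x | k < |u x|})
        (b := volume.real {x | h < |u x|}) (L := c₁ * κ) (R := 2 * F) measureReal_nonneg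
        measureReal_nonneg (measureReal_mono (fun x hx => hkh.trans hx) hA) (by positivity) hθ
        hγ0.1 ?_).trans_eq (by ring)
      refine le_of_mul_le_mul_left ?_ hd
      have hpp : (h - k) ^ p = (h - k) ^ (p - 1) * (h - k) := by
        rw [← Real.rpow_add_one hd.ne', sub_add_cancel]
      rw [hpp, ← measureReal_def, ← hF] at e5
      linarith
    have := ae_abs_le_of_stampacchia (hfin u hu0 0 le_rfl) hk₀ (L := (c₁ * κ)⁻¹ * 2) (X := F)
      (by positivity) hF0 (half_pos hwpos) (sub_pos.2 hp) hγ0.2 hε hsmall hstep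
    filter_upwards [this] with x hx
    refine hx.trans ?_
    gcongr
    exact le_add_of_nonneg_left (by positivity)
  · have hβ : 1 < α / N := by
      have := hm.trans hm1
      rw [ENNReal.ofReal_lt_one, div_lt_one hα] at this
      exact (one_lt_div hN0).2 this
    refine ⟨((c₁ / p * κ)⁻¹ * 2 * (w / 2) ^ (α / N - 1) *
      2 ^ (p * (α / N) / (α / N - 1))) ^ (1 / p), by positivity, ?_⟩
    intro ψ c₂ hψ hpow J hJ hsing f hf u hu hu0 hsol k₀ hk₀ hsmall ε hε
    set E := (energy ψ J u).toReal with hE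
    have hE0 : 0 ≤ E := ENNReal.toReal_nonneg
    have hstep : ∀ k h, k₀ ≤ k → k < h → volume.real {x | h < |u x|} * (h - k) ^ p ≤
        (c₁ / p * κ)⁻¹ * 2 * E * volume.real {x | k < |u x|} ^ (α / N) := by
      intro k h hk hkh
      have hk0 := hk₀.trans hk
      have hd : 0 < h - k := sub_pos.2 hkh
      have hA := hfin u hu0 k hk0
      have hB := hfin u hu0 h (hk0.trans hkh.le)
      have e1 := le_lintegral_kernel hN hα hc₀ hJ hsing
        (measurableSet_lt (measurable_const (a := k)) hu.abs) hB hw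
        ((measure_mono fun x hx => hk.trans_lt hx).trans hsmall)
      have e2 := le_energy_of_jump hψ hJ hp hc₁ hpow hu hkh
      have h2 : 2 * ENNReal.ofReal (energy ψ J u).toReal =
          ENNReal.ofReal 2 * ENNReal.ofReal (energy ψ J u).toReal := by rw [ENNReal.ofReal_ofNat]
      have e5 := (mul_le_mul_right e1 _).trans e2
      rw [← ENNReal.ofReal_mul (by positivity),
        ← ENNReal.ofReal_toReal hsol.mem.energy_lt_top.ne, h2,
        ← ENNReal.ofReal_mul zero_le_two, ENNReal.ofReal_le_ofReal_iff (by positivity)] at e5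
      have := mul_le_of_mul_rpow_neg_le (a := volume.real {x | k < |u x|})
        (b := volume.real {x | h < |u x|}) (t := (h - k) ^ p) (L := c₁ / p * κ) (R := 2 * E)
        (γ := 0) measureReal_nonneg measureReal_nonneg
        (measureReal_mono (fun x hx => hkh.trans hx) hA) (by positivity) hθ le_rfl
        (by
          rw [Real.rpow_zero]
          linarith)
      rw [zero_add] at this
      exact this.trans_eq (by ring)
    have := ae_abs_le_of_stampacchia (hfin u hu0 0 le_rfl) hk₀ (L := (c₁ / p * κ)⁻¹ * 2) (X := E)
      (by positivity) hE0 (half_pos hwpos) (by linarith) hβ hε hsmall hstep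
    filter_upwards [this] with x hx
    refine hx.trans ?_
    gcongr
    exact le_add_of_nonneg_right (by positivity)

end NonlocalOrlicz

open NonlocalOrlicz

theorem theorem4p4 (N : ℕ) (hN : 1 ≤ N)
    (Ω : Set (EuclideanSpace ℝ (Fin N))) (hΩ : IsOpen Ω) (hΩb : Bornology.IsBounded Ω)
    (p : ℝ) (hp : 1 < p) (c₁ c₂ : ℝ) (hc₁ : 0 < c₁) (hc₂ : 0 < c₂)
    (α c₀ : ℝ) (hα : 0 < α) (hc₀ : 0 < c₀)
    (m : ENNReal) (hm : ENNReal.ofReal (N / α) < m) :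
    ∃ C : NNReal, 0 < C ∧
      ∀ ψ : ℝ → ℝ, NonlocalOrlicz.IsNonlinearity ψ → NonlocalOrlicz.IsPowerLike p c₁ c₂ ψ →
      ∀ J : EuclideanSpace ℝ (Fin N) → ℝ,
        NonlocalOrlicz.IsKernel J → NonlocalOrlicz.HasSingularity α c₀ J →
      ∀ f : EuclideanSpace ℝ (Fin N) → ℝ,
        MeasureTheory.MemLp f m (MeasureTheory.volume.restrict Ω) →
      ∀ u : EuclideanSpace ℝ (Fin N) → ℝ, NonlocalOrlicz.IsWeakSolution ψ J Ω f u →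
        MeasureTheory.MemLp u ⊤ (MeasureTheory.volume.restrict Ω) ∧
        MeasureTheory.eLpNorm u ⊤ (MeasureTheory.volume.restrict Ω) ≤
          C * (NonlocalOrlicz.energy ψ J u ^ (1 / p) +
            MeasureTheory.eLpNorm f m (MeasureTheory.volume.restrict Ω) ^ (1 / (p - 1))) := by
  obtain ⟨w, hw⟩ : ∃ w, w = volume.real (Metric.ball (0 : EuclideanSpace ℝ (Fin N)) 1) := ⟨_, rfl⟩
  have hwpos : 0 < w := by
    rw [hw]
    exact ENNReal.toReal_pos (Metric.measure_ball_pos _ _ one_pos).ne' measure_ball_lt_top.ne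
  obtain ⟨C₁, hC₁, hlevel⟩ := exists_volume_superlevel_le hN hΩb hp hc₁ hα hc₀
  obtain ⟨C₂, hC₂, hbound⟩ := exists_ae_abs_le hN hΩb hp hc₁ hα hc₀ hm hw
  have hp0 : 0 < p := by linarith
  have hp1 : 0 < p - 1 := by linarith
  have hCpos : 0 < (2 * C₁ / w) ^ (1 / p) + C₂ := by positivity
  refine ⟨((2 * C₁ / w) ^ (1 / p) + C₂).toNNReal, Real.toNNReal_pos.2 hCpos, ?_⟩
  intro ψ hψ hpow J hJ hsing f hf u hu
  -- A measurable representative that vanishes everywhere off `Ω`.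
  obtain ⟨v, hv, hv0, huv⟩ : ∃ v : EuclideanSpace ℝ (Fin N) → ℝ, Measurable v ∧
      (∀ x, x ∉ Ω → v x = 0) ∧ u =ᵐ[volume] v := by
    refine ⟨Ω.indicator (hu.mem.aemeasurable.mk u),
      hu.mem.aemeasurable.measurable_mk.indicator hΩ.measurableSet,
      fun x hx => indicator_of_notMem hx _, ?_⟩
    filter_upwards [hu.mem.aemeasurable.ae_eq_mk, hu.mem.eq_zero] with x hx hx0
    by_cases hxΩ : x ∈ Ω
    · rw [indicator_of_mem hxΩ, hx]
    · rw [indicator_of_notMem hxΩ, hx0 hxΩ]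
  have hvsol := hu.congr_ae huv
  have hEtop := hvsol.mem.energy_lt_top.ne
  rw [energy_congr_ae (ψ := ψ) (J := J) huv]
  set E := (energy ψ J v).toReal with hE
  set F := (eLpNorm f m (volume.restrict Ω)).toReal with hF
  have hE0 : 0 ≤ E := ENNReal.toReal_nonneg
  have hF0 : 0 ≤ F := ENNReal.toReal_nonneg
  have hae : ∀ ε : ℝ, 0 < ε → ∀ᵐ x, |v x| ≤
      ((2 * C₁ / w) ^ (1 / p) + C₂) * (E ^ (1 / p) + F ^ (1 / (p - 1))) + (ε + ε) := by
    intro ε hε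
    set k₀ := (2 * C₁ / w) ^ (1 / p) * E ^ (1 / p) + ε with hk₀
    have hk₀pos : 0 < k₀ := by positivity
    have hkp : 2 * C₁ / w * E ≤ k₀ ^ p := by
      calc 2 * C₁ / w * E = ((2 * C₁ / w) ^ (1 / p) * E ^ (1 / p)) ^ p := by
            rw [← Real.mul_rpow (by positivity) hE0, ← Real.rpow_mul (by positivity),
              one_div_mul_cancel hp0.ne', Real.rpow_one]
        _ ≤ k₀ ^ p := Real.rpow_le_rpow (by positivity) (by linarith) hp0.le
    have hkpos : 0 < k₀ ^ p := by positivity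
    have hsmall : volume {x | k₀ < |v x|} ≤ ENNReal.ofReal (w / 2) := by
      have h1 := hlevel ψ c₂ hψ hpow J hJ hsing v hv hv0 k₀ hk₀pos.le
      rw [← ENNReal.ofReal_toReal hEtop, ← ENNReal.ofReal_mul hC₁.le] at h1
      have h2 : C₁ * E ≤ k₀ ^ p * (w / 2) := by
        calc C₁ * E = 2 * C₁ / w * E * (w / 2) := by field_simp
          _ ≤ _ := by gcongr
      have h3 := h1.trans (ENNReal.ofReal_le_ofReal h2)
      rw [ENNReal.ofReal_mul hkpos.le] at h3
      exact (ENNReal.mul_le_mul_iff_right (ENNReal.ofReal_pos.2 hkpos).ne'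
        ENNReal.ofReal_ne_top).1 h3
    filter_upwards [hbound ψ c₂ hψ hpow J hJ hsing f hf v hv hv0 hvsol k₀ hk₀pos.le hsmall ε hε]
      with x hx
    refine hx.trans ?_
    have : 0 ≤ (2 * C₁ / w) ^ (1 / p) * F ^ (1 / (p - 1)) := by positivity
    rw [hk₀]
    linarith
  have hnorm : eLpNorm u ⊤ (volume.restrict Ω) ≤
      ENNReal.ofReal (((2 * C₁ / w) ^ (1 / p) + C₂) * (E ^ (1 / p) + F ^ (1 / (p - 1)))) := by
    refine ENNReal.le_of_forall_pos_le_add fun ε hε _ => ?_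
    rw [← ENNReal.ofReal_coe_nnreal, ← ENNReal.ofReal_add (by positivity) ε.coe_nonneg,
      eLpNorm_exponent_top]
    refine eLpNormEssSup_le_of_ae_bound (ae_restrict_of_ae ?_)
    filter_upwards [hae (ε / 2) (by positivity), huv] with x hx hxv
    rw [hxv, Real.norm_eq_abs]
    linarith
  refine ⟨⟨hu.mem.aemeasurable.aestronglyMeasurable.restrict,
    hnorm.trans_lt ENNReal.ofReal_lt_top⟩, hnorm.trans_eq ?_⟩
  rw [ENNReal.ofReal_mul hCpos.le,
    ENNReal.ofReal_add (p := E ^ (1 / p)) (by positivity) (by positivity),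
    ← ENNReal.ofReal_rpow_of_nonneg hE0 (by positivity),
    ← ENNReal.ofReal_rpow_of_nonneg hF0 (by positivity), hE, hF, ENNReal.ofReal_toReal hEtop,
    ENNReal.ofReal_toReal hf.eLpNorm_ne_top]
  rfl
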